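/- Lemma 3.4 (Total Variation of Truncated Normals). For $\boldsymbol\mu\in\mathbb{R}^d$ and a symmetric positive definite $\boldsymbol\Sigma\in\mathbb{R}^{d\times d}$ let $\mathcal{N}(\boldsymbol\mu,\boldsymbol\Sigma)$ be the normal distribution on $\mathbb{R}^d$ with mean $\boldsymbol\mu$ and covariance matrix $\boldsymbol\Sigma$, let $\mathcal{N}(\boldsymbol\mu,\boldsymbol\Sigma;S)$ be the mass it gives to a measurable set $S\subseteq\mathbb{R}^d$, and, when this mass is positive, let $\mathcal{N}(\boldsymbol\mu,\boldsymbol\Sigma,S)$ be $\mathcal{N}(\boldsymbol\mu,\boldsymbol\Sigma)$ conditioned on $S$. For probability measures let $d_{\mathrm{TV}}(P,Q)=\sup_A|P(A)-Q(A)|$, the supremum being over measurable sets $A$. For every $\alpha\in(0,1]$ there is a constant $C_\alpha$ with $0<C_\alpha<\alpha/8$, depending only on $\alpha$ and satisfying $C_\alpha=\Omega(\alpha^3)$ (that is, there is an absolute constant $c>0$ with $C_\alpha\ge c\,\alpha^3$ for all $\alpha\in(0,1]$), such that the following holds. Let $d$ be any dimension, let $\boldsymbol\mu_1,\boldsymbol\mu_2\in\mathbb{R}^d$,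 let $\boldsymbol\Sigma_1,\boldsymbol\Sigma_2\in\mathbb{R}^{d\times d}$ be symmetric positive definite, and let $S_1,S_2\subseteq\mathbb{R}^d$ be measurable sets with $\mathcal{N}(\boldsymbol\mu_1,\boldsymbol\Sigma_1;S_1)\ge\alpha$ and $\mathcal{N}(\boldsymbol\mu_2,\boldsymbol\Sigma_2;S_2)\ge\alpha$. Then $$d_{\mathrm{TV}}\bigl(\mathcal{N}(\boldsymbol\mu_1,\boldsymbol\Sigma_1,S_1),\,\mathcal{N}(\boldsymbol\mu_2,\boldsymbol\Sigma_2,S_2)\bigr)\;\ge\;C_\alpha\; d_{\mathrm{TV}}\bigl(\mathcal{N}(\boldsymbol\mu_1,\boldsymbol\Sigma_1),\,\mathcal{N}(\boldsymbol\mu_2,\boldsymbol\Sigma_2)\bigr).$$ -/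

import Mathlib

open MeasureTheory ProbabilityTheory

/-- Total variation distance `sup_A |P(A) - Q(A)|` over measurable sets `A`, normalised so that it
lies in `[0, 1]` for probability measures. -/
noncomputable def tvDist {Ω : Type*} [MeasurableSpace Ω] (P Q : Measure Ω) : ℝ :=
  ⨆ A : {A : Set Ω // MeasurableSet A}, |P.real A.1 - Q.real A.1|

/-- The normal distribution `N(μ, Σ)` on `ℝ^d` conditioned on taking values in `S`. -/
noncomputable def truncatedNormal {d : ℕ} (μ : EuclideanSpace ℝ (Fin d))
    (Sig : Matrix (Fin d) (Fin d) ℝ) (S : Set (EuclideanSpace ℝ (Fin d))) :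
    Measure (EuclideanSpace ℝ (Fin d)) :=
  ProbabilityTheory.cond (multivariateGaussian μ Sig) S

/-!
Truncation cannot bring two normal distributions `P` and `Q` much closer, because their
log-likelihood ratio `F` is a quadratic polynomial, and such a polynomial is not concentrated near
any value on a set of substantial Gaussian mass.

A congruence diagonalizing both covariance matrices (`exists_measurableEquiv_map_pi`) makes `P`
standard and `Q` a product, so that `F` is a sum of quadratics in independent standard Gaussian
variables, with variance `σ ^ 2` under `P`. Two dimension-free estimates in terms of `σ` are
compared.

* Upper bound (`tvDist_pi_gaussianReal_le`): `1 - exp F ≤ |F|` bounds the distance of `P` and `Q`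
  by the first absolute moment of `F`. For `σ ≤ 1 / 2` the mean of `F` is `O(σ ^ 2)`, so this
  moment is `O(σ)`; for larger `σ` the trivial bound `1` suffices.
* Lower bound (`le_tvDist_cond`): the densities of the conditioned measures on `S₁` differ by a
  factor of at least `exp δ` away from the event that `F` lies within `δ` of `log (Q S₂ / P S₁)`.
  By `measureReal_abs_diagQuadratic_sub_le` that event has `P`-probability `O((δ / σ) ^ (1 / 2))`,
  at most half of `P S₁ ≥ α` when `δ` is a small multiple of `α ^ 2 * min 1 σ`.

The small ball estimate is the heart of the matter. The characteristic function of `F` is a product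
of explicit one-dimensional Gaussian integrals, whose moduli multiply up to a decay like
`(σ * |s|) ^ (-1 / 2)`; Gaussian smoothing turns this decay into a bound on the probability of
intervals. The resulting constant is of order `α ^ 2`, which is more than the required `α ^ 3`.
-/

/-! ### Total variation distance -/

section TotalVariation

variable {Ω Ω' : Type*} [MeasurableSpace Ω] [MeasurableSpace Ω']

lemma abs_measureReal_sub_le_one (P Q : Measure Ω) [IsProbabilityMeasure P]
    [IsProbabilityMeasure Q] (A : Set Ω) : |P.real A - Q.real A| ≤ 1 := by
  have h1 : P.real A ≤ 1 := measureReal_le_one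
  have h2 : Q.real A ≤ 1 := measureReal_le_one
  have h3 : 0 ≤ P.real A := measureReal_nonneg
  have h4 : 0 ≤ Q.real A := measureReal_nonneg
  rw [abs_le]; constructor <;> linarith

lemma le_tvDist (P Q : Measure Ω) [IsProbabilityMeasure P] [IsProbabilityMeasure Q]
    {A : Set Ω} (hA : MeasurableSet A) : |P.real A - Q.real A| ≤ tvDist P Q :=
  le_ciSup (f := fun A : {A : Set Ω // MeasurableSet A} ↦ |P.real A.1 - Q.real A.1|)
    ⟨1, by rintro _ ⟨A, rfl⟩; exact abs_measureReal_sub_le_one P Q A⟩ ⟨A, hA⟩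

lemma tvDist_le {P Q : Measure Ω} {r : ℝ}
    (h : ∀ A, MeasurableSet A → |P.real A - Q.real A| ≤ r) : tvDist P Q ≤ r :=
  haveI : Nonempty {A : Set Ω // MeasurableSet A} := ⟨⟨∅, .empty⟩⟩
  ciSup_le fun A ↦ h A.1 A.2

lemma tvDist_le_one (P Q : Measure Ω) [IsProbabilityMeasure P] [IsProbabilityMeasure Q] :
    tvDist P Q ≤ 1 :=
  tvDist_le fun A _ ↦ abs_measureReal_sub_le_one P Q A

lemma tvDist_nonneg (P Q : Measure Ω) : 0 ≤ tvDist P Q :=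
  Real.iSup_nonneg fun _ ↦ abs_nonneg _

/-- Data processing inequality; applied to an isomorphism and its inverse, it shows that the
total variation distance does not depend on the coordinates. -/
lemma tvDist_map_le (P Q : Measure Ω) [IsProbabilityMeasure P] [IsProbabilityMeasure Q]
    {T : Ω → Ω'} (hT : Measurable T) : tvDist (P.map T) (Q.map T) ≤ tvDist P Q := by
  refine tvDist_le fun A hA ↦ ?_
  rw [map_measureReal_apply hT hA, map_measureReal_apply hT hA]
  exact le_tvDist P Q (hT hA)

lemma cond_eq_map_cond_map (P : Measure Ω) (e : Ω ≃ᵐ Ω') {S : Set Ω'} (hS : MeasurableSet S) :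
    cond P (e ⁻¹' S) = (cond (P.map e) S).map e.symm := by
  ext A hA
  rw [Measure.map_apply e.symm.measurable hA, cond_apply hS, cond_apply (e.measurable hS),
    Measure.map_apply e.measurable hS,
    Measure.map_apply e.measurable (hS.inter (e.symm.measurable hA))]
  congr 2
  ext x
  simp

variable {P Q : Measure Ω} [IsProbabilityMeasure Q] {F : Ω → ℝ}

lemma integrable_exp_of_withDensity (hF : Measurable F)
    (hQ : Q = P.withDensity fun x ↦ ENNReal.ofReal (Real.exp (F x))) :
    Integrable (fun x ↦ Real.exp (F x)) P := by
  refine ⟨by fun_prop, ?_⟩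
  rw [hasFiniteIntegral_iff_ofReal (ae_of_all _ fun x ↦ (Real.exp_pos _).le)]
  have h : Q Set.univ = 1 := measure_univ
  rw [hQ, withDensity_apply _ .univ, setLIntegral_univ] at h
  simp [h]

lemma measureReal_withDensity_exp (hF : Measurable F)
    (hQ : Q = P.withDensity fun x ↦ ENNReal.ofReal (Real.exp (F x)))
    {A : Set Ω} (hA : MeasurableSet A) : Q.real A = ∫ x in A, Real.exp (F x) ∂P := by
  have hint := integrable_exp_of_withDensity hF hQ
  rw [measureReal_def, hQ, withDensity_apply _ hA,
    ← ofReal_integral_eq_lintegral_ofReal hint.integrableOn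
      (ae_of_all _ fun x ↦ (Real.exp_pos _).le),
    ENNReal.toReal_ofReal (integral_nonneg fun x ↦ (Real.exp_pos _).le)]

variable [IsProbabilityMeasure P]

/-- The total variation distance is at most the first absolute moment of the log-likelihood
ratio, because `1 - exp F ≤ |F|`. -/
lemma tvDist_le_integral_abs (hF : Measurable F)
    (hQ : Q = P.withDensity fun x ↦ ENNReal.ofReal (Real.exp (F x))) (hFi : Integrable F P) :
    tvDist P Q ≤ ∫ x, |F x| ∂P := by
  have key : ∀ A, MeasurableSet A → P.real A - Q.real A ≤ ∫ x, |F x| ∂P := by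
    intro A hA
    have hint := integrable_exp_of_withDensity hF hQ
    have h1 : P.real A = ∫ x in A, (1 : ℝ) ∂P := by simp
    rw [measureReal_withDensity_exp hF hQ hA, h1,
      ← integral_sub (integrable_const _) hint.integrableOn]
    calc ∫ x in A, (1 - Real.exp (F x)) ∂P ≤ ∫ x in A, |F x| ∂P := by
          refine integral_mono ((integrable_const _).sub hint.integrableOn)
            hFi.abs.integrableOn fun x ↦ ?_
          have h2 := Real.add_one_le_exp (F x)
          have h3 := neg_abs_le (F x)
          simp only
          linarith
      _ ≤ ∫ x, |F x| ∂P :=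
          setIntegral_le_integral hFi.abs (ae_of_all _ fun x ↦ abs_nonneg _)
  refine tvDist_le fun A hA ↦ abs_le.2 ⟨?_, key A hA⟩
  have h := key Aᶜ hA.compl
  rw [probReal_compl_eq_one_sub hA, probReal_compl_eq_one_sub hA] at h
  linarith

/-- If the log-likelihood ratio `F` leaves every window of radius `δ` with sufficient probability,
then conditioning cannot bring the two measures close. The relevant window is the one around
`log (Q S₂ / P S₁)`: outside it the conditioned densities differ by a factor of at least
`exp δ`, on a set of conditional probability at least `1 / 2`. -/
lemma le_tvDist_cond (hF : Measurable F)
    (hQ : Q = P.withDensity fun x ↦ ENNReal.ofReal (Real.exp (F x)))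
    {S₁ S₂ : Set Ω} (hS₁ : MeasurableSet S₁) (hS₂ : MeasurableSet S₂)
    (h₁ : 0 < P.real S₁) (h₂ : 0 < Q.real S₂) {δ : ℝ} (hδ : 0 < δ) (hδ1 : δ ≤ 1)
    (hconc : ∀ t, P.real {x | |F x - t| ≤ δ} ≤ P.real S₁ / 2) :
    δ / 8 ≤ tvDist (cond P S₁) (cond Q S₂) := by
  have hint := integrable_exp_of_withDensity hF hQ
  set a := P.real S₁ with ha
  set b := Q.real S₂ with hb
  have hPne : P S₁ ≠ 0 := fun h ↦ by simp [ha, measureReal_def, h] at h₁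
  have hQne : Q S₂ ≠ 0 := fun h ↦ by simp [hb, measureReal_def, h] at h₂
  have := cond_isProbabilityMeasure (μ := P) hPne
  have := cond_isProbabilityMeasure (μ := Q) hQne
  have hcP : ∀ A, (cond P S₁).real A = a⁻¹ * P.real (S₁ ∩ A) := fun A ↦ by
    rw [measureReal_def, cond_apply hS₁, ENNReal.toReal_mul, ENNReal.toReal_inv]; rfl
  have hcQ : ∀ A, (cond Q S₂).real A = b⁻¹ * Q.real (S₂ ∩ A) := fun A ↦ by
    rw [measureReal_def, cond_apply hS₂, ENNReal.toReal_mul, ENNReal.toReal_inv]; rfl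
  set t := Real.log (b / a) with ht
  have het : Real.exp t = b / a := Real.exp_log (by positivity)
  -- Where the second conditioned density is the smaller one, and where it is the larger one.
  set E := S₁ ∩ (S₂ᶜ ∪ {x | F x ≤ t - δ}) with hE
  set G := S₁ ∩ (S₂ ∩ {x | t + δ ≤ F x}) with hG
  have hEm : MeasurableSet E :=
    hS₁.inter (hS₂.compl.union (measurableSet_le hF measurable_const))
  have hGm : MeasurableSet G :=
    hS₁.inter (hS₂.inter (measurableSet_le measurable_const hF))
  have hcover : S₁ ⊆ (E ∪ G) ∪ {x | |F x - t| ≤ δ} := by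
    intro x hx
    by_cases h : |F x - t| ≤ δ
    · exact .inr h
    · left
      by_cases hx2 : x ∈ S₂
      · rcases lt_abs.1 (not_le.1 h) with h | h
        · exact .inr ⟨hx, hx2, by simp only [Set.mem_ofPred_eq]; linarith⟩
        · exact .inl ⟨hx, .inr (by simp only [Set.mem_ofPred_eq]; linarith)⟩
      · exact .inl ⟨hx, .inl hx2⟩
  have hsum : a / 2 ≤ P.real E + P.real G := by
    have h3 : a ≤ P.real (E ∪ G) + P.real {x | |F x - t| ≤ δ} :=
      (measureReal_mono hcover).trans (measureReal_union_le _ _)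
    have h4 := measureReal_union_le (μ := P) E G
    have h5 := hconc t
    linarith
  rcases le_total (a / 4) (P.real E) with hcase | hcase
  · have hQE : Q.real (S₂ ∩ E) ≤ (b / a * Real.exp (-δ)) * P.real E := by
      rw [measureReal_withDensity_exp hF hQ (hS₂.inter hEm)]
      calc ∫ x in S₂ ∩ E, Real.exp (F x) ∂P
          ≤ ∫ x in S₂ ∩ E, (b / a * Real.exp (-δ)) ∂P := by
            refine setIntegral_mono_on hint.integrableOn (integrable_const _)
              (hS₂.inter hEm) ?_
            rintro x ⟨hx2, -, hx | hx⟩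
            · exact absurd hx2 hx
            · rw [← het, ← Real.exp_add]
              exact Real.exp_le_exp.2 (by simpa [sub_eq_add_neg] using hx)
        _ = (b / a * Real.exp (-δ)) * P.real (S₂ ∩ E) := by
            rw [setIntegral_const, smul_eq_mul, mul_comm]
        _ ≤ _ := by
            gcongr
            · exact measure_ne_top _ _
            · exact Set.inter_subset_right
    have hle := (le_abs_self _).trans (le_tvDist (cond P S₁) (cond Q S₂) hEm)
    rw [hcP, hcQ, Set.inter_eq_right.2 (Set.inter_subset_left : E ⊆ S₁)] at hle
    have h6 : b⁻¹ * Q.real (S₂ ∩ E) ≤ a⁻¹ * P.real E * Real.exp (-δ) := by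
      calc b⁻¹ * Q.real (S₂ ∩ E) ≤ b⁻¹ * ((b / a * Real.exp (-δ)) * P.real E) := by gcongr
        _ = _ := by field_simp
    have h7 : 1 / 4 ≤ a⁻¹ * P.real E := by
      rw [inv_mul_eq_div, le_div_iff₀ h₁]; linarith
    have h8 : Real.exp (-δ) ≤ 1 - δ / 2 := by
      rw [Real.exp_neg, inv_le_comm₀ (Real.exp_pos _) (by linarith)]
      refine le_trans ?_ (Real.add_one_le_exp δ)
      rw [inv_le_iff_one_le_mul₀ (by linarith)]
      nlinarith
    nlinarith [Real.exp_pos (-δ)]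
  · have hGge : a / 4 ≤ P.real G := by linarith
    have hQG : (b / a * Real.exp δ) * P.real G ≤ Q.real (S₂ ∩ G) := by
      have hG2 : S₂ ∩ G = G := Set.inter_eq_right.2 fun x hx ↦ hx.2.1
      rw [hG2, measureReal_withDensity_exp hF hQ hGm]
      calc (b / a * Real.exp δ) * P.real G = ∫ x in G, (b / a * Real.exp δ) ∂P := by
            rw [setIntegral_const, smul_eq_mul, mul_comm]
        _ ≤ ∫ x in G, Real.exp (F x) ∂P := by
            refine setIntegral_mono_on (integrable_const _) hint.integrableOn hGm ?_
            rintro x ⟨-, -, hx⟩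
            rw [← het, ← Real.exp_add]
            exact Real.exp_le_exp.2 hx
    have hle := (neg_abs_le _).trans' (neg_le_neg (le_tvDist (cond P S₁) (cond Q S₂) hGm))
    rw [hcP, hcQ, Set.inter_eq_right.2 (Set.inter_subset_left : G ⊆ S₁)] at hle
    have h6 : a⁻¹ * P.real G * Real.exp δ ≤ b⁻¹ * Q.real (S₂ ∩ G) := by
      calc _ = b⁻¹ * ((b / a * Real.exp δ) * P.real G) := by field_simp
        _ ≤ _ := by gcongr
    have h7 : 1 / 4 ≤ a⁻¹ * P.real G := by
      rw [inv_mul_eq_div, le_div_iff₀ h₁]; linarith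
    have h8 := Real.add_one_le_exp δ
    nlinarith

end TotalVariation

/-! ### Small ball estimates from decay of the characteristic function -/

section SmallBall

lemma integrable_abs_rpow_neg_half_gaussianReal :
    Integrable (fun g : ℝ ↦ |g| ^ (-(1 / 2) : ℝ)) (gaussianReal 0 1) := by
  rw [gaussianReal_of_var_ne_zero 0 one_ne_zero,
    integrable_withDensity_iff_integrable_smul' (measurable_gaussianPDF _ _)
      (ae_of_all _ fun _ ↦ gaussianPDF_lt_top)]
  have hIoi := integrableOn_rpow_mul_exp_neg_mul_sq (b := 1 / 2) (by norm_num)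
    (s := -(1 / 2)) (by norm_num)
  set f : ℝ → ℝ := fun x ↦ |x| ^ (-(1 / 2) : ℝ) * Real.exp (-(1 / 2) * x ^ 2) with hf
  have h1 : IntegrableOn f (Set.Ioi 0) := by
    refine hIoi.congr_fun (fun x hx ↦ ?_) measurableSet_Ioi
    simp only [hf, abs_of_pos (Set.mem_Ioi.1 hx)]
  have h2 : IntegrableOn f (Set.Iic 0) := by
    have hm : MeasurableEmbedding fun x : ℝ ↦ -x := (Homeomorph.neg ℝ).measurableEmbedding
    rw [← Measure.map_neg_eq_self (volume : Measure ℝ), hm.integrableOn_map_iff]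
    have h3 : f ∘ (fun x : ℝ ↦ -x) = f := by
      ext x
      simp [hf]
    rw [h3]
    simpa using (integrableOn_Ici_iff_integrableOn_Ioi (by finiteness)).2 h1
  have h4 : Integrable f := by
    rw [← integrableOn_univ, ← Set.Iic_union_Ioi (a := (0 : ℝ))]
    exact h2.union h1
  refine (h4.const_mul (Real.sqrt (2 * Real.pi))⁻¹).congr (ae_of_all _ fun x ↦ ?_)
  simp only [toReal_gaussianPDF, gaussianPDFReal, hf, smul_eq_mul, NNReal.coe_one, mul_one,
    sub_zero]
  rw [show -x ^ 2 / 2 = -(1 / 2) * x ^ 2 by ring]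
  ring

/-- Gaussian smoothing: the average of a Gaussian bump of width `δ` around `t` is a Gaussian
average of the characteristic function at frequencies of order `1 / δ`. -/
lemma integral_exp_neg_sq_eq (ν : Measure ℝ) [IsProbabilityMeasure ν] (t δ : ℝ) :
    ((∫ x, Real.exp (-((x - t) / δ) ^ 2 / 2) ∂ν : ℝ) : ℂ) =
      ∫ g, Complex.exp (-(t / δ * g : ℝ) * Complex.I) * charFun ν (g / δ) ∂(gaussianReal 0 1) := by
  calc ((∫ x, Real.exp (-((x - t) / δ) ^ 2 / 2) ∂ν : ℝ) : ℂ)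
      = ∫ x, charFun (gaussianReal 0 1) ((x - t) / δ) ∂ν := by
        rw [← integral_complex_ofReal]
        refine integral_congr_ae (ae_of_all _ fun x ↦ ?_)
        simp only [charFun_gaussianReal]
        push_cast
        congr 1
        simp
        ring
    _ = ∫ x, ∫ g, Complex.exp (((x - t) / δ : ℝ) * g * Complex.I) ∂(gaussianReal 0 1) ∂ν := by
        simp_rw [charFun_apply_real]
    _ = ∫ g, ∫ x, Complex.exp (((x - t) / δ : ℝ) * g * Complex.I) ∂ν ∂(gaussianReal 0 1) := by
        refine integral_integral_swap ?_
        refine Integrable.of_bound (C := 1) ?_ (ae_of_all _ fun p ↦ ?_)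
        · exact Measurable.aestronglyMeasurable (by unfold Function.uncurry; fun_prop)
        · simp only [Function.uncurry, ← Complex.ofReal_mul, Complex.norm_exp_ofReal_mul_I, le_refl]
    _ = _ := by
        refine integral_congr_ae (ae_of_all _ fun g ↦ ?_)
        simp only [charFun_apply_real]
        rw [← integral_const_mul]
        refine integral_congr_ae (ae_of_all _ fun x ↦ ?_)
        simp only [← Complex.exp_add]
        congr 1
        push_cast
        ring

/-- Constant of the small ball estimate `measureReal_abs_sub_le`. -/
noncomputable def smallBallConst : ℝ :=
  max 1 (Real.exp (1 / 2) * ∫ g, |g| ^ (-(1 / 2) : ℝ) ∂(gaussianReal 0 1))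

lemma one_le_smallBallConst : 1 ≤ smallBallConst := le_max_left _ _

lemma measureReal_abs_sub_le (ν : Measure ℝ) [IsProbabilityMeasure ν] {σ δ : ℝ}
    (hσ : 0 < σ) (hδ : 0 < δ)
    (hν : ∀ s, s ≠ 0 → ‖charFun ν s‖ ≤ (σ * |s|) ^ (-(1 / 2) : ℝ)) (t : ℝ) :
    ν.real {x | |x - t| ≤ δ} ≤ smallBallConst * (δ / σ) ^ (1 / 2 : ℝ) := by
  set γ := gaussianReal 0 1 with hγ
  have : NullSingletonClass γ := nullSingletonClass_gaussianReal one_ne_zero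
  have hbump : ∫ x, Real.exp (-((x - t) / δ) ^ 2 / 2) ∂ν ≤
      (δ / σ) ^ (1 / 2 : ℝ) * ∫ g, |g| ^ (-(1 / 2) : ℝ) ∂γ := by
    calc ∫ x, Real.exp (-((x - t) / δ) ^ 2 / 2) ∂ν
        ≤ ‖((∫ x, Real.exp (-((x - t) / δ) ^ 2 / 2) ∂ν : ℝ) : ℂ)‖ := by
          rw [Complex.norm_real]; exact le_abs_self _
      _ ≤ ∫ g, (δ / σ) ^ (1 / 2 : ℝ) * |g| ^ (-(1 / 2) : ℝ) ∂γ := by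
          rw [integral_exp_neg_sq_eq]
          refine norm_integral_le_of_norm_le
            (integrable_abs_rpow_neg_half_gaussianReal.const_mul _) ?_
          -- The bound is false at `g = 0`, where the real power is `0`.
          filter_upwards [(Set.countable_singleton (0 : ℝ)).ae_notMem γ] with g hg
          have hg0 : g ≠ 0 := hg
          rw [norm_mul, ← Complex.ofReal_neg, Complex.norm_exp_ofReal_mul_I, one_mul]
          refine (hν _ (div_ne_zero hg0 hδ.ne')).trans (le_of_eq ?_)
          rw [abs_div, abs_of_pos hδ, show σ * (|g| / δ) = (δ / σ)⁻¹ * |g| by field_simp,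
            Real.mul_rpow (by positivity) (abs_nonneg g), Real.inv_rpow (by positivity),
            Real.rpow_neg (by positivity), inv_inv]
      _ = _ := integral_const_mul _ _
  have hmark : ν.real {x | |x - t| ≤ δ} ≤
      Real.exp (1 / 2) * ∫ x, Real.exp (-((x - t) / δ) ^ 2 / 2) ∂ν := by
    have hm : MeasurableSet {x : ℝ | |x - t| ≤ δ} :=
      measurableSet_le (by fun_prop) measurable_const
    have hb : Integrable (fun x ↦ Real.exp (1 / 2) * Real.exp (-((x - t) / δ) ^ 2 / 2)) ν := by
      refine Integrable.const_mul (Integrable.of_bound (C := 1) ?_ (ae_of_all _ fun x ↦ ?_)) _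
      · exact Measurable.aestronglyMeasurable (by fun_prop)
      · rw [Real.norm_eq_abs, abs_of_pos (Real.exp_pos _), Real.exp_le_one_iff]
        nlinarith [sq_nonneg ((x - t) / δ)]
    rw [← integral_const_mul, ← integral_indicator_one hm]
    refine integral_mono ((integrable_const (1 : ℝ)).indicator hm) hb fun x ↦ ?_
    by_cases hx : x ∈ {x : ℝ | |x - t| ≤ δ}
    swap
    · rw [Set.indicator_of_notMem hx]; positivity
    rw [Set.indicator_of_mem hx]
    have hx' : |(x - t) / δ| ≤ 1 := by
      rw [abs_div, abs_of_pos hδ, div_le_one hδ]; exact hx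
    have hx2 : ((x - t) / δ) ^ 2 ≤ 1 := by
      rw [← sq_abs]; nlinarith [abs_nonneg ((x - t) / δ)]
    rw [← Real.exp_add, Pi.one_apply, Real.one_le_exp_iff]
    linarith
  have hpow : 0 ≤ (δ / σ) ^ (1 / 2 : ℝ) := by positivity
  calc ν.real {x | |x - t| ≤ δ}
      ≤ Real.exp (1 / 2) * ((δ / σ) ^ (1 / 2 : ℝ) * ∫ g, |g| ^ (-(1 / 2) : ℝ) ∂γ) :=
        hmark.trans (by gcongr)
    _ = (Real.exp (1 / 2) * ∫ g, |g| ^ (-(1 / 2) : ℝ) ∂γ) * (δ / σ) ^ (1 / 2 : ℝ) := by ring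
    _ ≤ _ := mul_le_mul_of_nonneg_right (le_max_right _ _) hpow

end SmallBall

/-! ### Characteristic function of a Gaussian quadratic polynomial -/

section Quadratic

lemma integral_cexp_quadratic_gaussianReal (a b c : ℝ) :
    ∫ x, Complex.exp ((a * x ^ 2 + b * x + c : ℝ) * Complex.I) ∂(gaussianReal 0 1) =
      ((Real.sqrt (2 * Real.pi))⁻¹ : ℝ) *
        ((Real.pi / -(-(1 / 2) + a * Complex.I)) ^ (1 / 2 : ℂ) *
          Complex.exp (c * Complex.I -
            (b * Complex.I) ^ 2 / (4 * (-(1 / 2) + a * Complex.I)))) := by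
  rw [integral_gaussianReal_eq_integral_smul one_ne_zero, ← integral_cexp_quadratic (by simp),
    ← integral_const_mul]
  refine integral_congr_ae (ae_of_all _ fun x ↦ ?_)
  simp only [gaussianPDFReal, NNReal.coe_one, mul_one, sub_zero, Complex.real_smul]
  push_cast
  rw [mul_assoc, ← Complex.exp_add]
  congr 2
  ring

/-- The two factors of the modulus come from the quadratic and the linear part of the polynomial;
`1 + u ≤ exp u` merges them into one bound in terms of the variance `2 * a ^ 2 + b ^ 2`. -/
lemma norm_integral_cexp_quadratic_gaussianReal (a b c : ℝ) :
    ‖∫ x, Complex.exp ((a * x ^ 2 + b * x + c : ℝ) * Complex.I) ∂(gaussianReal 0 1)‖ ^ 4 *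
      (1 + 2 * (2 * a ^ 2 + b ^ 2)) ≤ 1 := by
  set β : ℂ := -(1 / 2) + a * Complex.I with hβ
  set u : ℝ := 1 + 4 * a ^ 2 with hu
  have hu0 : 0 < u := by positivity
  have hβn : Complex.normSq β = u / 4 := by
    simp [hβ, Complex.normSq_apply, hu]; ring
  have hβ0 : β ≠ 0 := fun h ↦ by rw [h] at hβn; simp at hβn; linarith
  have hexp : ‖Complex.exp (c * Complex.I - (b * Complex.I) ^ 2 / (4 * β))‖ =
      Real.exp (-(b ^ 2 / (2 * u))) := by
    rw [Complex.norm_exp]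
    congr 1
    have h1 : (c * Complex.I - (b * Complex.I) ^ 2 / (4 * β)) =
        c * Complex.I + ((b ^ 2 / 4 : ℝ) : ℂ) * β⁻¹ := by
      rw [mul_pow, Complex.I_sq]; push_cast; field_simp; ring
    rw [h1, Complex.add_re, Complex.re_ofReal_mul, Complex.re_ofReal_mul, Complex.inv_re, hβn]
    simp [hβ]
    field_simp
  have hpow : ‖(Real.pi / -β) ^ (1 / 2 : ℂ)‖ ^ 4 = (2 * Real.pi) ^ 2 / u := by
    have h1 : ‖(Real.pi / -β) ^ (1 / 2 : ℂ)‖ ^ 2 = ‖(Real.pi / -β : ℂ)‖ := by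
      rw [← norm_pow, ← Complex.cpow_nat_mul]
      simp
    rw [show 4 = 2 * 2 by rfl, pow_mul, h1, ← Complex.normSq_eq_norm_sq, Complex.normSq_div,
      Complex.normSq_neg, hβn, Complex.normSq_ofReal]
    field_simp
    ring
  have hsq : (Real.sqrt (2 * Real.pi))⁻¹ ^ 4 = ((2 * Real.pi) ^ 2)⁻¹ := by
    rw [inv_pow, show 4 = 2 * 2 by rfl, pow_mul, Real.sq_sqrt (by positivity)]
  rw [integral_cexp_quadratic_gaussianReal, norm_mul, norm_mul, hexp, mul_pow, mul_pow, hpow,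
    Complex.norm_real, Real.norm_eq_abs, abs_of_nonneg (by positivity), hsq, ← Real.exp_nat_mul]
  have hpi := Real.pi_pos
  have h2 : ((2 * Real.pi) ^ 2)⁻¹ * ((2 * Real.pi) ^ 2 / u *
      Real.exp ((4 : ℕ) * -(b ^ 2 / (2 * u)))) * (1 + 2 * (2 * a ^ 2 + b ^ 2)) =
      (1 + 2 * b ^ 2 / u) * Real.exp (-(2 * b ^ 2 / u)) := by
    rw [show ((4 : ℕ) : ℝ) * -(b ^ 2 / (2 * u)) = -(2 * b ^ 2 / u) by push_cast; field_simp; ring]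
    field_simp
    rw [hu]; ring
  rw [h2, Real.exp_neg, ← div_eq_mul_inv, div_le_one (Real.exp_pos _), add_comm]
  exact Real.add_one_le_exp _

lemma one_add_sum_le_prod_one_add {ι : Type*} {w : ι → ℝ} (hw : ∀ i, 0 ≤ w i) (s : Finset ι) :
    1 + ∑ i ∈ s, w i ≤ ∏ i ∈ s, (1 + w i) := by
  classical
  induction s using Finset.induction_on with
  | empty => simp
  | insert i s hi ih =>
    rw [Finset.sum_insert hi, Finset.prod_insert hi]
    have := hw i
    have := Finset.sum_nonneg fun j (_ : j ∈ s) ↦ hw j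
    nlinarith

variable {ι : Type*} [Fintype ι]

/-- The polynomial `∑ i, (a i * x i ^ 2 + b i * x i + c i)` in the coordinates of `x`. -/
def diagQuadratic (a b c : ι → ℝ) (x : ι → ℝ) : ℝ :=
  ∑ i, (a i * x i ^ 2 + b i * x i + c i)

@[fun_prop]
lemma measurable_diagQuadratic (a b c : ι → ℝ) : Measurable (diagQuadratic a b c) := by
  unfold diagQuadratic; fun_prop

lemma charFun_map_diagQuadratic (a b c : ι → ℝ) (s : ℝ) :
    charFun ((Measure.pi fun _ : ι ↦ gaussianReal 0 1).map (diagQuadratic a b c)) s =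
      ∏ i, ∫ x, Complex.exp ((s * a i * x ^ 2 + s * b i * x + s * c i : ℝ) * Complex.I)
        ∂(gaussianReal 0 1) := by
  rw [charFun_apply_real, integral_map (by fun_prop) (by fun_prop),
    ← integral_fintype_prod_eq_prod]
  refine integral_congr_ae (ae_of_all _ fun x ↦ ?_)
  simp only [← Complex.exp_sum, diagQuadratic]
  push_cast
  rw [← Finset.sum_mul, Finset.mul_sum]
  congr 2
  exact Finset.sum_congr rfl fun i _ ↦ by ring

/-- With `σ ^ 2 = ∑ i, (2 * a i ^ 2 + b i ^ 2)` the variance of the polynomial, the characteristic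
function decays like `(σ * |s|) ^ (-1 / 2)`, uniformly in the dimension: bounding a product of
factors `1 + w i` below by `1 + ∑ i, w i` loses no dimensional constant. -/
lemma norm_charFun_map_diagQuadratic_le (a b c : ι → ℝ) {σ : ℝ} (hσ : 0 < σ)
    (hσ2 : ∑ i, (2 * a i ^ 2 + b i ^ 2) = σ ^ 2) {s : ℝ} (hs : s ≠ 0) :
    ‖charFun ((Measure.pi fun _ : ι ↦ gaussianReal 0 1).map (diagQuadratic a b c)) s‖ ≤
      (σ * |s|) ^ (-(1 / 2) : ℝ) := by
  rw [charFun_map_diagQuadratic]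
  set φ : ι → ℂ := fun i ↦ ∫ x, Complex.exp
    ((s * a i * x ^ 2 + s * b i * x + s * c i : ℝ) * Complex.I) ∂(gaussianReal 0 1) with hφ
  set r := σ * |s| with hr
  have hr0 : 0 < r := mul_pos hσ (abs_pos.2 hs)
  have h1 : ‖∏ i, φ i‖ ^ 4 * ∏ i, (1 + 2 * (2 * (s * a i) ^ 2 + (s * b i) ^ 2)) ≤ 1 := by
    rw [norm_prod, ← Finset.prod_pow, ← Finset.prod_mul_distrib]
    exact Finset.prod_le_one (fun i _ ↦ by positivity)
      fun i _ ↦ norm_integral_cexp_quadratic_gaussianReal _ _ _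
  have h2 : r ^ 2 ≤ ∏ i, (1 + 2 * (2 * (s * a i) ^ 2 + (s * b i) ^ 2)) := by
    have h3 := one_add_sum_le_prod_one_add
      (w := fun i ↦ 2 * (2 * (s * a i) ^ 2 + (s * b i) ^ 2)) (fun i ↦ by positivity) Finset.univ
    have h4 : ∑ i, 2 * (2 * (s * a i) ^ 2 + (s * b i) ^ 2) = 2 * r ^ 2 := by
      rw [hr, mul_pow, sq_abs, ← hσ2, Finset.sum_mul, Finset.mul_sum]
      exact Finset.sum_congr rfl fun i _ ↦ by ring
    nlinarith [sq_nonneg r]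
  have h5 : ‖∏ i, φ i‖ ^ 4 ≤ (r ^ (-(1 / 2) : ℝ)) ^ 4 := by
    have h6 : (r ^ (-(1 / 2) : ℝ)) ^ 4 = (r ^ 2)⁻¹ := by
      rw [← Real.rpow_natCast, ← Real.rpow_mul hr0.le, ← Real.rpow_natCast, ← Real.rpow_neg hr0.le]
      norm_num
    rw [h6, ← one_div, le_div_iff₀ (by positivity)]
    exact (mul_le_mul_of_nonneg_left h2 (by positivity)).trans h1
  exact le_of_pow_le_pow_left₀ (by norm_num) (by positivity) h5

/-- Dimension-free small ball estimate for a quadratic polynomial in independent standard Gaussian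
variables. -/
lemma measureReal_abs_diagQuadratic_sub_le (a b c : ι → ℝ) {σ δ : ℝ} (hσ : 0 < σ) (hδ : 0 < δ)
    (hσ2 : ∑ i, (2 * a i ^ 2 + b i ^ 2) = σ ^ 2) (t : ℝ) :
    (Measure.pi fun _ : ι ↦ gaussianReal 0 1).real {x | |diagQuadratic a b c x - t| ≤ δ} ≤
      smallBallConst * (δ / σ) ^ (1 / 2 : ℝ) := by
  have hm := measurable_diagQuadratic a b c
  have : IsProbabilityMeasure
      ((Measure.pi fun _ : ι ↦ gaussianReal 0 1).map (diagQuadratic a b c)) :=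
    Measure.isProbabilityMeasure_map hm.aemeasurable
  have h := measureReal_abs_sub_le
    ((Measure.pi fun _ : ι ↦ gaussianReal 0 1).map (diagQuadratic a b c)) hσ hδ
    (fun s hs ↦ norm_charFun_map_diagQuadratic_le a b c hσ hσ2 hs) t
  rwa [map_measureReal_apply hm (measurableSet_le (by fun_prop) measurable_const)] at h

end Quadratic

/-! ### Gaussian product measures and their log-likelihood ratio -/

section LogLikelihood

/-- Quadratic coefficient of the log-likelihood ratio of `N(m, v)` to `N(0, 1)`. -/
noncomputable def llrQuad (v : NNReal) : ℝ := (1 - (v : ℝ)⁻¹) / 2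

/-- Linear coefficient of the log-likelihood ratio of `N(m, v)` to `N(0, 1)`. -/
noncomputable def llrLin (m : ℝ) (v : NNReal) : ℝ := m * (v : ℝ)⁻¹

/-- Constant coefficient of the log-likelihood ratio of `N(m, v)` to `N(0, 1)`. -/
noncomputable def llrConst (m : ℝ) (v : NNReal) : ℝ :=
  Real.log (v : ℝ)⁻¹ / 2 - m ^ 2 * (v : ℝ)⁻¹ / 2

lemma gaussianReal_eq_withDensity_exp (m : ℝ) {v : NNReal} (hv : v ≠ 0) :
    gaussianReal m v = (gaussianReal 0 1).withDensity fun x ↦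
      ENNReal.ofReal (Real.exp (llrQuad v * x ^ 2 + llrLin m v * x + llrConst m v)) := by
  rw [gaussianReal_of_var_ne_zero m hv, gaussianReal_of_var_ne_zero 0 one_ne_zero,
    ← withDensity_mul _ (measurable_gaussianPDF _ _) (by fun_prop)]
  congr 1
  ext x
  have hv0 : (0 : ℝ) < v := by positivity
  rw [Pi.mul_apply, gaussianPDF, gaussianPDF, ← ENNReal.ofReal_mul (gaussianPDFReal_nonneg _ _ _)]
  congr 1
  have hlog : Real.exp (Real.log (v : ℝ)⁻¹ / 2) = (Real.sqrt v)⁻¹ := by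
    rw [← Real.log_sqrt (by positivity), Real.exp_log (by positivity), Real.sqrt_inv]
  have hexp : Real.exp (llrQuad v * x ^ 2 + llrLin m v * x + llrConst m v) =
      (Real.sqrt v)⁻¹ * Real.exp (-(x - m) ^ 2 / (2 * v) + x ^ 2 / 2) := by
    rw [← hlog, ← Real.exp_add, llrQuad, llrLin, llrConst]
    congr 1
    field_simp
    ring
  rw [hexp, gaussianPDFReal, gaussianPDFReal, Real.exp_add, Real.sqrt_mul (by positivity)]
  simp only [NNReal.coe_one, mul_one, sub_zero, neg_div, Real.exp_neg]
  field_simp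

variable {ι : Type*} [Fintype ι]

lemma pi_withDensity_eq {X : ι → Type*} [∀ i, MeasurableSpace (X i)] (μ : ∀ i, Measure (X i))
    [∀ i, IsProbabilityMeasure (μ i)] {f : ∀ i, X i → ENNReal} (hf : ∀ i, Measurable (f i))
    [∀ i, SigmaFinite ((μ i).withDensity (f i))] :
    Measure.pi (fun i ↦ (μ i).withDensity (f i)) =
      (Measure.pi μ).withDensity fun x ↦ ∏ i, f i (x i) := by
  refine Measure.pi_eq fun s hs ↦ ?_
  have hm : ∀ i, Measurable ((s i).indicator (f i)) := fun i ↦ (hf i).indicator (hs i)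
  rw [withDensity_apply _ (MeasurableSet.univ_pi hs),
    ← lintegral_indicator (MeasurableSet.univ_pi hs)]
  have h1 : ∀ x : ∀ i, X i, (Set.univ.pi s).indicator (fun x ↦ ∏ i, f i (x i)) x =
      ∏ i, (s i).indicator (f i) (x i) := by
    intro x
    by_cases hx : ∀ i, x i ∈ s i
    · rw [Set.indicator_of_mem (by simpa using hx)]
      exact Finset.prod_congr rfl fun i _ ↦ (Set.indicator_of_mem (hx i) _).symm
    · rw [Set.indicator_of_notMem (by simpa using hx)]
      obtain ⟨i, hi⟩ := not_forall.1 hx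
      exact (Finset.prod_eq_zero (Finset.mem_univ i) (Set.indicator_of_notMem hi _)).symm
  simp_rw [h1]
  refine (lintegral_prod_eq_prod_lintegral_of_indepFun Finset.univ
    (fun i (x : ∀ i, X i) ↦ (s i).indicator (f i) (x i)) (iIndepFun_pi fun i ↦ (hm i).aemeasurable)
    fun i ↦ (hm i).comp (measurable_pi_apply i)).trans ?_
  refine Finset.prod_congr rfl fun i _ ↦ ?_
  rw [(measurePreserving_eval μ i).lintegral_comp (hm i), lintegral_indicator (hs i),
    withDensity_apply _ (hs i)]

/-- Log-likelihood ratio of the product of the `N(m i, v i)` to the standard Gaussian measure. -/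
noncomputable def gaussianLLR (m : ι → ℝ) (v : ι → NNReal) : (ι → ℝ) → ℝ :=
  diagQuadratic (fun i ↦ llrQuad (v i)) (fun i ↦ llrLin (m i) (v i))
    (fun i ↦ llrConst (m i) (v i))

/-- Variance of `gaussianLLR m v` under the standard Gaussian measure. -/
noncomputable def gaussianLLRVar (m : ι → ℝ) (v : ι → NNReal) : ℝ :=
  ∑ i, (2 * llrQuad (v i) ^ 2 + llrLin (m i) (v i) ^ 2)

lemma gaussianLLRVar_nonneg (m : ι → ℝ) (v : ι → NNReal) : 0 ≤ gaussianLLRVar m v :=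
  Finset.sum_nonneg fun _ _ ↦ by positivity

@[fun_prop]
lemma measurable_gaussianLLR (m : ι → ℝ) (v : ι → NNReal) : Measurable (gaussianLLR m v) :=
  measurable_diagQuadratic _ _ _

lemma pi_gaussianReal_eq_withDensity_exp (m : ι → ℝ) {v : ι → NNReal} (hv : ∀ i, v i ≠ 0) :
    Measure.pi (fun i ↦ gaussianReal (m i) (v i)) =
      (Measure.pi fun _ : ι ↦ gaussianReal 0 1).withDensity fun x ↦
        ENNReal.ofReal (Real.exp (gaussianLLR m v x)) := by
  have h := fun i ↦ gaussianReal_eq_withDensity_exp (m i) (hv i)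
  have : ∀ i, SigmaFinite ((gaussianReal 0 1).withDensity fun x ↦ ENNReal.ofReal
      (Real.exp (llrQuad (v i) * x ^ 2 + llrLin (m i) (v i) * x + llrConst (m i) (v i)))) :=
    fun i ↦ by rw [← h i]; infer_instance
  simp_rw [h]
  rw [pi_withDensity_eq (fun _ ↦ gaussianReal 0 1) fun i ↦ by fun_prop]
  congr 1
  ext x
  rw [gaussianLLR, diagQuadratic, Real.exp_sum,
    ENNReal.ofReal_prod_of_nonneg fun i _ ↦ (Real.exp_pos _).le]

lemma memLp_sq_gaussianReal : MemLp (fun x : ℝ ↦ x ^ 2) 2 (gaussianReal 0 1) := by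
  have h := (memLp_id_gaussianReal' (μ := 0) (v := 1) 4 (by norm_num)).norm_rpow_div 2
  have h2 : (4 : ENNReal) / 2 = 2 := by
    rw [show (4 : ENNReal) = 2 * 2 by norm_num]
    exact ENNReal.mul_div_cancel_right (by norm_num) (by norm_num)
  rw [h2] at h
  simpa using h

lemma memLp_quadratic_gaussianReal (a b c : ℝ) :
    MemLp (fun x : ℝ ↦ a * x ^ 2 + b * x + c) 2 (gaussianReal 0 1) :=
  ((memLp_sq_gaussianReal.const_mul a).add (IsGaussian.memLp_two_id.const_mul b)).add
    (memLp_const c)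

lemma integral_sq_gaussianReal : ∫ x : ℝ, x ^ 2 ∂(gaussianReal 0 1) = 1 := by
  have h := variance_eq_sub (IsGaussian.memLp_two_id (μ := gaussianReal 0 1))
  simpa using h.symm

lemma integral_quadratic_gaussianReal (a b c : ℝ) :
    ∫ x : ℝ, (a * x ^ 2 + b * x + c) ∂(gaussianReal 0 1) = a + c := by
  have h1 : Integrable (fun x : ℝ ↦ a * x ^ 2) (gaussianReal 0 1) :=
    (memLp_sq_gaussianReal.integrable (by norm_num)).const_mul a
  have h2 : Integrable (fun x : ℝ ↦ b * x) (gaussianReal 0 1) :=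
    (IsGaussian.integrable_id (μ := gaussianReal 0 1)).const_mul b
  have h3 : Integrable (fun x : ℝ ↦ a * x ^ 2 + b * x) (gaussianReal 0 1) := h1.add h2
  rw [integral_add h3 (integrable_const c), integral_add h1 h2, integral_const_mul,
    integral_const_mul, integral_sq_gaussianReal]
  simp

/-- A constant `K` with `Var[a * x ^ 2 + b * x + c] ≤ K * (2 * a ^ 2 + b ^ 2)` under the standard
Gaussian measure. The sharp value is `1`; finiteness of `K` is all that matters here, which
saves the computation of the fourth moment. -/
noncomputable def quadraticVarConst : ℝ :=
  2 + ∫ x : ℝ, (x ^ 2 - 1) ^ 2 ∂(gaussianReal 0 1)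

lemma two_le_quadraticVarConst : 2 ≤ quadraticVarConst :=
  le_add_of_nonneg_right (integral_nonneg fun _ ↦ sq_nonneg _)

lemma variance_quadratic_gaussianReal_le (a b c : ℝ) :
    Var[fun x : ℝ ↦ a * x ^ 2 + b * x + c; gaussianReal 0 1] ≤
      quadraticVarConst * (2 * a ^ 2 + b ^ 2) := by
  have hL := memLp_quadratic_gaussianReal a b c
  have hL1 := memLp_quadratic_gaussianReal 1 0 (-1)
  rw [← variance_sub_const hL.aestronglyMeasurable (a + c)]
  refine (variance_le_expectation_sq
    (hL.sub (memLp_const (a + c))).aestronglyMeasurable).trans ?_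
  have h1 : Integrable (fun x : ℝ ↦ (2 * a ^ 2) * (x ^ 2 - 1) ^ 2) (gaussianReal 0 1) := by
    refine Integrable.const_mul ?_ _
    refine hL1.integrable_sq.congr (ae_of_all _ fun x ↦ ?_)
    ring
  have h2 : Integrable (fun x : ℝ ↦ (2 * b ^ 2) * x ^ 2) (gaussianReal 0 1) :=
    (memLp_sq_gaussianReal.integrable (by norm_num)).const_mul _
  calc ∫ x : ℝ, ((fun x : ℝ ↦ a * x ^ 2 + b * x + c - (a + c)) ^ 2) x ∂(gaussianReal 0 1)
      ≤ ∫ x : ℝ, ((2 * a ^ 2) * (x ^ 2 - 1) ^ 2 + (2 * b ^ 2) * x ^ 2) ∂(gaussianReal 0 1) := by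
        refine integral_mono (hL.sub (memLp_const (a + c))).integrable_sq (h1.add h2) fun x ↦ ?_
        simp only [Pi.pow_apply]
        nlinarith [sq_nonneg (a * (x ^ 2 - 1) - b * x)]
    _ = (2 * a ^ 2) * (∫ x : ℝ, (x ^ 2 - 1) ^ 2 ∂(gaussianReal 0 1)) + 2 * b ^ 2 := by
        rw [integral_add h1 h2, integral_const_mul, integral_const_mul, integral_sq_gaussianReal,
          mul_one]
    _ ≤ _ := by
        have h3 : 0 ≤ ∫ x : ℝ, (x ^ 2 - 1) ^ 2 ∂(gaussianReal 0 1) :=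
          integral_nonneg fun _ ↦ sq_nonneg _
        rw [quadraticVarConst]
        nlinarith [sq_nonneg a, sq_nonneg b, mul_nonneg (sq_nonneg b) h3]

/-- The mean of the log-likelihood ratio, minus a Kullback-Leibler divergence, is of second order
in the deviation of `N(m, v)` from `N(0, 1)`. -/
lemma abs_llrQuad_add_llrConst_le (m : ℝ) {v : NNReal} (hv : v ≠ 0)
    (h : 2 * llrQuad v ^ 2 + llrLin m v ^ 2 ≤ 1 / 4) :
    |llrQuad v + llrConst m v| ≤ 4 * (2 * llrQuad v ^ 2 + llrLin m v ^ 2) := by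
  have hκ : (0 : ℝ) < (v : ℝ)⁻¹ := by positivity
  simp only [llrQuad, llrLin, llrConst] at *
  set κ := (v : ℝ)⁻¹ with hκd
  have h1 : 1 / 4 ≤ κ := by nlinarith [sq_nonneg (m * κ)]
  have h2 := Real.log_le_sub_one_of_pos hκ
  have h3 := Real.one_sub_inv_le_log_of_pos hκ
  have hinv : κ⁻¹ ≤ 4 := by rw [inv_le_comm₀ hκ (by norm_num)]; linarith
  have h4 : κ - 1 - Real.log κ ≤ 4 * (1 - κ) ^ 2 := by
    have h5 : κ - 1 - (1 - κ⁻¹) = (1 - κ) ^ 2 * κ⁻¹ := by field_simp; ring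
    nlinarith [mul_le_mul_of_nonneg_left hinv (sq_nonneg (1 - κ))]
  have h6 : m ^ 2 * κ ≤ 4 * (m * κ) ^ 2 := by
    have h7 : m ^ 2 * κ = (m * κ) ^ 2 * κ⁻¹ := by field_simp
    rw [h7]
    nlinarith [mul_le_mul_of_nonneg_left hinv (sq_nonneg (m * κ))]
  have h8 : 0 ≤ m ^ 2 * κ := by positivity
  rw [abs_le]
  constructor
  · nlinarith [sq_nonneg (m * κ), sq_nonneg (1 - κ)]
  · nlinarith [sq_nonneg (m * κ), sq_nonneg (1 - κ)]

lemma memLp_gaussianLLR (m : ι → ℝ) (v : ι → NNReal) :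
    MemLp (gaussianLLR m v) 2 (Measure.pi fun _ : ι ↦ gaussianReal 0 1) := by
  unfold gaussianLLR diagQuadratic
  refine memLp_finsetSum _ fun i _ ↦ ?_
  exact (memLp_quadratic_gaussianReal _ _ _).comp_measurePreserving
    (measurePreserving_eval (fun _ : ι ↦ gaussianReal 0 1) i)

lemma variance_gaussianLLR_le (m : ι → ℝ) (v : ι → NNReal) :
    Var[gaussianLLR m v; Measure.pi fun _ : ι ↦ gaussianReal 0 1] ≤
      quadraticVarConst * gaussianLLRVar m v := by
  have h := variance_sum_pi (μ := fun _ : ι ↦ gaussianReal 0 1)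
    (X := fun i x ↦ llrQuad (v i) * x ^ 2 + llrLin (m i) (v i) * x + llrConst (m i) (v i))
    fun i ↦ memLp_quadratic_gaussianReal _ _ _
  have h1 : gaussianLLR m v = ∑ i, fun ω : ι → ℝ ↦
      llrQuad (v i) * ω i ^ 2 + llrLin (m i) (v i) * ω i + llrConst (m i) (v i) := by
    ext x
    simp [gaussianLLR, diagQuadratic]
  rw [h1, h, gaussianLLRVar, Finset.mul_sum]
  exact Finset.sum_le_sum fun i _ ↦ variance_quadratic_gaussianReal_le _ _ _

lemma abs_integral_gaussianLLR_le (m : ι → ℝ) {v : ι → NNReal} (hv : ∀ i, v i ≠ 0)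
    (h : gaussianLLRVar m v ≤ 1 / 4) :
    |∫ x, gaussianLLR m v x ∂(Measure.pi fun _ : ι ↦ gaussianReal 0 1)| ≤
      4 * gaussianLLRVar m v := by
  have h1 : ∫ x, gaussianLLR m v x ∂(Measure.pi fun _ : ι ↦ gaussianReal 0 1) =
      ∑ i, (llrQuad (v i) + llrConst (m i) (v i)) := by
    unfold gaussianLLR diagQuadratic
    have hL := fun i ↦ memLp_quadratic_gaussianReal (llrQuad (v i)) (llrLin (m i) (v i))
      (llrConst (m i) (v i))
    rw [integral_finsetSum _ fun i _ ↦ integrable_comp_eval (μ := fun _ : ι ↦ gaussianReal 0 1)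
      ((hL i).integrable (by norm_num))]
    refine Finset.sum_congr rfl fun i _ ↦ ?_
    exact (integral_comp_eval (μ := fun _ : ι ↦ gaussianReal 0 1)
      (hL i).aestronglyMeasurable).trans (integral_quadratic_gaussianReal _ _ _)
  rw [h1, gaussianLLRVar, Finset.mul_sum]
  refine (Finset.abs_sum_le_sum_abs _ _).trans (Finset.sum_le_sum fun i _ ↦ ?_)
  refine abs_llrQuad_add_llrConst_le _ (hv i) (le_trans ?_ h)
  exact Finset.single_le_sum (f := fun i ↦ 2 * llrQuad (v i) ^ 2 + llrLin (m i) (v i) ^ 2)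
    (fun j _ ↦ by positivity) (Finset.mem_univ i)

lemma integral_abs_gaussianLLR_le (m : ι → ℝ) {v : ι → NNReal} (hv : ∀ i, v i ≠ 0) {σ : ℝ}
    (hσ : 0 < σ) (hσ1 : σ ≤ 1 / 2) (hσ2 : gaussianLLRVar m v = σ ^ 2) :
    ∫ x, |gaussianLLR m v x| ∂(Measure.pi fun _ : ι ↦ gaussianReal 0 1) ≤
      (quadraticVarConst + 5) / 2 * σ := by
  set P := Measure.pi fun _ : ι ↦ gaussianReal 0 1 with hP
  set F := gaussianLLR m v with hF
  have hL : MemLp F 2 P := memLp_gaussianLLR m v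
  have hvar : Var[F; P] ≤ quadraticVarConst * σ ^ 2 := hσ2 ▸ variance_gaussianLLR_le m v
  have hmean : |∫ x, F x ∂P| ≤ 2 * σ := by
    refine (abs_integral_gaussianLLR_le m hv (by nlinarith)).trans ?_
    nlinarith
  have hsq : ∫ x, F x ^ 2 ∂P ≤ (quadraticVarConst + 4) * σ ^ 2 := by
    have h1 := variance_eq_sub hL
    simp only [Pi.pow_apply] at h1
    have h2 : (∫ x, F x ∂P) ^ 2 ≤ (2 * σ) ^ 2 := sq_le_sq' (abs_le.1 hmean).1 (abs_le.1 hmean).2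
    nlinarith
  calc ∫ x, |F x| ∂P ≤ ∫ x, ((2 * σ)⁻¹ * F x ^ 2 + σ / 2) ∂P := by
        refine integral_mono (hL.integrable (by norm_num)).abs
          ((hL.integrable_sq.const_mul _).add (integrable_const _)) fun x ↦ ?_
        have h3 : (2 * σ)⁻¹ * F x ^ 2 + σ / 2 - |F x| = (2 * σ)⁻¹ * (|F x| - σ) ^ 2 := by
          rw [← sq_abs (F x)]; field_simp; ring
        have h4 : 0 ≤ (2 * σ)⁻¹ * (|F x| - σ) ^ 2 := by positivity
        simp only
        linarith
    _ = (2 * σ)⁻¹ * (∫ x, F x ^ 2 ∂P) + σ / 2 := by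
        rw [integral_add (hL.integrable_sq.const_mul _) (integrable_const _), integral_const_mul]
        simp
    _ ≤ (2 * σ)⁻¹ * ((quadraticVarConst + 4) * σ ^ 2) + σ / 2 := by gcongr
    _ = _ := by field_simp; ring

end LogLikelihood

/-! ### Truncation of product Gaussian measures -/

section ProductTruncation

variable {ι : Type*} [Fintype ι]

/-- Constant of the upper bound `tvDist_pi_gaussianReal_le`. -/
noncomputable def tvUpperConst : ℝ := (quadraticVarConst + 5) / 2

lemma two_le_tvUpperConst : 2 ≤ tvUpperConst := by
  have := two_le_quadraticVarConst
  rw [tvUpperConst]; linarith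

lemma gaussianLLR_eq_zero {m : ι → ℝ} {v : ι → NNReal} (h : gaussianLLRVar m v = 0)
    (x : ι → ℝ) : gaussianLLR m v x = 0 := by
  rw [gaussianLLRVar, Finset.sum_eq_zero_iff_of_nonneg fun i _ ↦ by positivity] at h
  refine Finset.sum_eq_zero fun i hi ↦ ?_
  have h1 := h i hi
  have h2 : llrQuad (v i) = 0 := by
    nlinarith [sq_nonneg (llrQuad (v i)), sq_nonneg (llrLin (m i) (v i))]
  have h3 : llrLin (m i) (v i) = 0 := by
    nlinarith [sq_nonneg (llrQuad (v i)), sq_nonneg (llrLin (m i) (v i))]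
  have h4 : ((v i : ℝ))⁻¹ = 1 := by rw [llrQuad] at h2; linarith
  have h5 : m i = 0 := by rwa [llrLin, h4, mul_one] at h3
  simp only [h2, h3]
  simp [llrConst, h4, h5]

lemma tvDist_pi_gaussianReal_le (m : ι → ℝ) {v : ι → NNReal} (hv : ∀ i, v i ≠ 0) :
    tvDist (Measure.pi fun _ : ι ↦ gaussianReal 0 1)
        (Measure.pi fun i ↦ gaussianReal (m i) (v i)) ≤
      tvUpperConst * min 1 (Real.sqrt (gaussianLLRVar m v)) := by
  set σ := Real.sqrt (gaussianLLRVar m v) with hσ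
  have hσ0 : 0 ≤ σ := Real.sqrt_nonneg _
  have hC := two_le_tvUpperConst
  have hσ2 : gaussianLLRVar m v = σ ^ 2 := (Real.sq_sqrt (gaussianLLRVar_nonneg m v)).symm
  rcases le_or_gt σ (1 / 2) with h | h
  · rw [min_eq_right (by linarith)]
    refine (tvDist_le_integral_abs (measurable_gaussianLLR m v)
      (pi_gaussianReal_eq_withDensity_exp m hv)
      ((memLp_gaussianLLR m v).integrable (by norm_num))).trans ?_
    rcases hσ0.eq_or_lt with h0 | h0
    · have h1 := gaussianLLR_eq_zero (m := m) (v := v) (by rw [hσ2, ← h0]; norm_num)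
      simp [h1, ← h0]
    · exact integral_abs_gaussianLLR_le m hv h0 h hσ2
  · refine (tvDist_le_one _ _).trans ?_
    have h1 : 1 / 2 ≤ min 1 σ := le_min (by norm_num) h.le
    nlinarith

lemma mul_tvDist_pi_le_tvDist_cond (m : ι → ℝ) {v : ι → NNReal} (hv : ∀ i, v i ≠ 0)
    {S₁ S₂ : Set (ι → ℝ)} (hS₁ : MeasurableSet S₁) (hS₂ : MeasurableSet S₂) {α : ℝ}
    (hα : 0 < α) (hα1 : α ≤ 1)
    (h₁ : α ≤ (Measure.pi fun _ : ι ↦ gaussianReal 0 1).real S₁)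
    (h₂ : 0 < (Measure.pi fun i ↦ gaussianReal (m i) (v i)).real S₂) :
    α ^ 2 / (32 * smallBallConst ^ 2 * tvUpperConst) *
        tvDist (Measure.pi fun _ : ι ↦ gaussianReal 0 1)
          (Measure.pi fun i ↦ gaussianReal (m i) (v i)) ≤
      tvDist (cond (Measure.pi fun _ : ι ↦ gaussianReal 0 1) S₁)
        (cond (Measure.pi fun i ↦ gaussianReal (m i) (v i)) S₂) := by
  have hub := tvDist_pi_gaussianReal_le m hv
  set P := Measure.pi fun _ : ι ↦ gaussianReal 0 1 with hP
  set Q := Measure.pi fun i ↦ gaussianReal (m i) (v i) with hQ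
  set σ := Real.sqrt (gaussianLLRVar m v) with hσ
  have hK := one_le_smallBallConst
  have hC := two_le_tvUpperConst
  set K := smallBallConst
  set C := tvUpperConst
  have hK0 : 0 < K := by linarith
  have hC0 : 0 < C := by linarith
  have hσ0 : 0 ≤ σ := Real.sqrt_nonneg _
  rcases hσ0.eq_or_lt with h0 | h0
  · rw [← h0, min_eq_right zero_le_one, mul_zero] at hub
    exact (mul_nonpos_of_nonneg_of_nonpos (by positivity) hub).trans (tvDist_nonneg _ _)
  -- The window radius for which the small ball estimate gives at most `α / 2`.
  set δ := min 1 σ * (α / (2 * K)) ^ 2 with hδ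
  have hmin : 0 < min 1 σ := lt_min one_pos h0
  have hδ0 : 0 < δ := by positivity
  have hα2 : α / (2 * K) ≤ 1 := by rw [div_le_one (by positivity)]; linarith
  have hα3 : (α / (2 * K)) ^ 2 ≤ 1 := pow_le_one₀ (by positivity) hα2
  have hδ1 : δ ≤ 1 := (mul_le_of_le_one_right hmin.le hα3).trans (min_le_left _ _)
  have hconc : ∀ t, P.real {x | |gaussianLLR m v x - t| ≤ δ} ≤ P.real S₁ / 2 := by
    intro t
    refine (measureReal_abs_diagQuadratic_sub_le _ _ _ h0 hδ0
      (Real.sq_sqrt (gaussianLLRVar_nonneg m v)).symm t).trans ?_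
    have h3 : δ / σ ≤ (α / (2 * K)) ^ 2 := by
      rw [div_le_iff₀ h0, mul_comm]
      exact mul_le_mul_of_nonneg_right (min_le_right 1 σ) (by positivity)
    have h4 : (δ / σ) ^ (1 / 2 : ℝ) ≤ α / (2 * K) := by
      rw [← Real.sqrt_eq_rpow]
      exact Real.sqrt_le_iff.2 ⟨by positivity, h3⟩
    calc K * (δ / σ) ^ (1 / 2 : ℝ) ≤ K * (α / (2 * K)) := by gcongr
      _ = α / 2 := by field_simp
      _ ≤ _ := by linarith
  have hmain := le_tvDist_cond (measurable_gaussianLLR m v)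
    (pi_gaussianReal_eq_withDensity_exp m hv) hS₁ hS₂ (hα.trans_le h₁) h₂ hδ0 hδ1 hconc
  calc α ^ 2 / (32 * K ^ 2 * C) * tvDist P Q
      ≤ α ^ 2 / (32 * K ^ 2 * C) * (C * min 1 σ) := by gcongr
    _ = δ / 8 := by rw [hδ]; field_simp; ring
    _ ≤ _ := hmain

end ProductTruncation

/-! ### Simultaneous diagonalization of two normal distributions -/

section Diagonalization

open Matrix
open scoped MatrixOrder RealInnerProductSpace

lemma map_pi_gaussianReal_affine {d : ℕ} (μ : EuclideanSpace ℝ (Fin d))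
    (L : Matrix (Fin d) (Fin d) ℝ) (m : Fin d → ℝ) (v : Fin d → NNReal) :
    (Measure.pi fun i ↦ gaussianReal (m i) (v i)).map
        (fun y ↦ μ + WithLp.toLp 2 (L *ᵥ y)) =
      multivariateGaussian (μ + WithLp.toLp 2 (L *ᵥ m))
        (L * diagonal (fun i ↦ (v i : ℝ)) * Lᵀ) := by
  have hpsd : (L * diagonal (fun i ↦ (v i : ℝ)) * Lᵀ).PosSemidef := by
    have h := (PosSemidef.diagonal (d := fun i ↦ (v i : ℝ))
      fun i ↦ (v i).coe_nonneg).mul_mul_conjTranspose_same L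
    rwa [conjTranspose_eq_transpose_of_trivial] at h
  have hmeas : Measurable fun y : Fin d → ℝ ↦ μ + WithLp.toLp 2 (L *ᵥ y) := by
    refine Continuous.measurable ?_
    fun_prop
  have := Measure.isProbabilityMeasure_map (μ := Measure.pi fun i ↦ gaussianReal (m i) (v i))
    hmeas.aemeasurable
  refine Measure.ext_of_charFun (funext fun t ↦ ?_)
  have hinner : ∀ y : Fin d → ℝ, ⟪μ + WithLp.toLp 2 (L *ᵥ y), t⟫ =
      ⟪μ, t⟫ + ∑ i, (Lᵀ *ᵥ t.ofLp) i * y i := by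
    intro y
    rw [inner_add_left]
    congr 1
    rw [EuclideanSpace.inner_eq_star_dotProduct]
    simp only [star_trivial]
    rw [dotProduct_mulVec, ← mulVec_transpose]
    rfl
  have hquad : t.ofLp ⬝ᵥ (L * diagonal (fun i ↦ (v i : ℝ)) * Lᵀ) *ᵥ t.ofLp =
      ∑ i, v i * (Lᵀ *ᵥ t.ofLp) i ^ 2 := by
    rw [← mulVec_mulVec, ← mulVec_mulVec, dotProduct_mulVec, ← mulVec_transpose, dotProduct]
    refine Finset.sum_congr rfl fun i _ ↦ ?_
    rw [mulVec_diagonal]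
    ring
  rw [charFun_multivariateGaussian hpsd, hquad, real_inner_comm, hinner, charFun_apply,
    integral_map hmeas.aemeasurable (by fun_prop)]
  simp_rw [hinner]
  have hsplit : ∀ y : Fin d → ℝ,
      Complex.exp (((⟪μ, t⟫ + ∑ i, (Lᵀ *ᵥ t.ofLp) i * y i : ℝ) : ℂ) * Complex.I) =
        Complex.exp (⟪μ, t⟫ * Complex.I) *
          ∏ i, Complex.exp ((Lᵀ *ᵥ t.ofLp) i * y i * Complex.I) := by
    intro y
    rw [← Complex.exp_sum, ← Complex.exp_add]
    push_cast
    rw [add_mul, Finset.sum_mul]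
  simp_rw [hsplit]
  rw [integral_const_mul, integral_fintype_prod_eq_prod
    (f := fun i (x : ℝ) ↦ Complex.exp ((Lᵀ *ᵥ t.ofLp) i * x * Complex.I))]
  simp_rw [← charFun_apply_real, charFun_gaussianReal]
  rw [← Complex.exp_sum, ← Complex.exp_add]
  congr 1
  push_cast
  rw [Finset.sum_sub_distrib, add_mul, Finset.sum_mul, Finset.sum_div]
  ring

/-- Two positive definite matrices are simultaneously diagonalized by a congruence. -/
lemma exists_isUnit_congruence {d : ℕ} {A B : Matrix (Fin d) (Fin d) ℝ} (hA : A.PosDef)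
    (hB : B.PosDef) : ∃ (L : Matrix (Fin d) (Fin d) ℝ) (v : Fin d → NNReal), IsUnit L ∧
      (∀ i, v i ≠ 0) ∧ A = L * Lᵀ ∧ B = L * diagonal (fun i ↦ (v i : ℝ)) * Lᵀ := by
  set R := CFC.sqrt A with hR
  have hRR : R * R = A := CFC.sqrt_mul_sqrt_self A hA.posSemidef.nonneg
  have hRT : Rᵀ = R := by
    have h : IsSelfAdjoint R := (CFC.sqrt_nonneg A).isSelfAdjoint
    rw [← conjTranspose_eq_transpose_of_trivial]
    exact h
  have hRu : IsUnit R := by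
    have h : IsUnit (R * R) := hRR ▸ hA.isUnit
    exact isUnit_of_mul_isUnit_left h
  have hdet : IsUnit R.det := (isUnit_iff_isUnit_det R).1 hRu
  have hRiT : (R⁻¹)ᵀ = R⁻¹ := by rw [transpose_nonsing_inv, hRT]
  have hN : (R⁻¹ * B * R⁻¹).PosDef := by
    have h := hB.mul_mul_conjTranspose_same (B := R⁻¹)
      (vecMul_injective_iff_isUnit.2 (isUnit_nonsing_inv_iff.2 hRu))
    rwa [conjTranspose_eq_transpose_of_trivial, hRiT] at h
  set U : Matrix (Fin d) (Fin d) ℝ :=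
    (hN.isHermitian.eigenvectorUnitary : Matrix (Fin d) (Fin d) ℝ) with hU
  have hUU : U * Uᵀ = 1 := by
    rw [← conjTranspose_eq_transpose_of_trivial]
    exact Unitary.coe_mul_star_self hN.isHermitian.eigenvectorUnitary
  have hspec : R⁻¹ * B * R⁻¹ = U * diagonal hN.isHermitian.eigenvalues * Uᵀ := by
    have h := hN.isHermitian.spectral_theorem
    rw [Unitary.conjStarAlgAut_apply] at h
    rw [← conjTranspose_eq_transpose_of_trivial]
    exact h
  refine ⟨R * U, fun i ↦ ⟨hN.isHermitian.eigenvalues i, (hN.eigenvalues_pos i).le⟩,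
    hRu.mul (IsUnit.of_mul_eq_one _ hUU), fun i h ↦ ?_, ?_, ?_⟩
  · exact (hN.eigenvalues_pos i).ne' (congrArg NNReal.toReal h)
  · rw [transpose_mul, hRT, Matrix.mul_assoc, ← Matrix.mul_assoc U, hUU, Matrix.one_mul, hRR]
  · change B = R * U * diagonal hN.isHermitian.eigenvalues * (R * U)ᵀ
    have h : R * U * diagonal hN.isHermitian.eigenvalues * (R * U)ᵀ =
        R * (U * diagonal hN.isHermitian.eigenvalues * Uᵀ) * R := by
      rw [transpose_mul, hRT]; simp only [Matrix.mul_assoc]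
    rw [h, ← hspec]
    simp only [Matrix.mul_assoc, nonsing_inv_mul R hdet, Matrix.mul_one]
    rw [← Matrix.mul_assoc, mul_nonsing_inv R hdet, Matrix.one_mul]

/-- The affine isomorphism `y ↦ μ + L y` from coordinate space to Euclidean space. -/
noncomputable def affineMeasurableEquiv {d : ℕ} (μ : EuclideanSpace ℝ (Fin d))
    {L : Matrix (Fin d) (Fin d) ℝ} (hL : IsUnit L) :
    (Fin d → ℝ) ≃ᵐ EuclideanSpace ℝ (Fin d) where
  toFun y := μ + WithLp.toLp 2 (L *ᵥ y)
  invFun z := L⁻¹ *ᵥ (z - μ).ofLp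
  left_inv y := by
    simp [nonsing_inv_mul L ((isUnit_iff_isUnit_det L).1 hL)]
  right_inv z := by
    simp [mul_nonsing_inv L ((isUnit_iff_isUnit_det L).1 hL)]
  measurable_toFun := by
    refine Continuous.measurable ?_
    change Continuous fun y ↦ μ + WithLp.toLp 2 (L *ᵥ y)
    fun_prop
  measurable_invFun := by
    refine Continuous.measurable ?_
    change Continuous fun z : EuclideanSpace ℝ (Fin d) ↦ L⁻¹ *ᵥ (z - μ).ofLp
    fun_prop

/-- Two nondegenerate normal distributions are, in common affine coordinates, the standard one and
a product of one-dimensional ones. -/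
lemma exists_measurableEquiv_map_pi {d : ℕ} (μ₁ μ₂ : EuclideanSpace ℝ (Fin d))
    {Sig₁ Sig₂ : Matrix (Fin d) (Fin d) ℝ} (h₁ : Sig₁.PosDef) (h₂ : Sig₂.PosDef) :
    ∃ (e : (Fin d → ℝ) ≃ᵐ EuclideanSpace ℝ (Fin d)) (m : Fin d → ℝ) (v : Fin d → NNReal),
      (∀ i, v i ≠ 0) ∧
      multivariateGaussian μ₁ Sig₁ = (Measure.pi fun _ ↦ gaussianReal 0 1).map e ∧
      multivariateGaussian μ₂ Sig₂ = (Measure.pi fun i ↦ gaussianReal (m i) (v i)).map e := by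
  obtain ⟨L, v, hL, hv, hA, hB⟩ := exists_isUnit_congruence h₁ h₂
  have he : ⇑(affineMeasurableEquiv μ₁ hL) = fun y ↦ μ₁ + WithLp.toLp 2 (L *ᵥ y) := rfl
  refine ⟨affineMeasurableEquiv μ₁ hL, L⁻¹ *ᵥ (μ₂ - μ₁).ofLp, v, hv, ?_, ?_⟩
  · have h := map_pi_gaussianReal_affine μ₁ L (fun _ ↦ 0) (fun _ ↦ 1)
    have hz : L *ᵥ (fun _ ↦ (0 : ℝ)) = 0 := mulVec_zero L
    have ho : diagonal (fun _ : Fin d ↦ ((1 : NNReal) : ℝ)) = 1 := by simp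
    rw [hz, ho, Matrix.mul_one, ← hA, WithLp.toLp_zero, add_zero] at h
    rw [he, h]
  · rw [he, map_pi_gaussianReal_affine, ← hB]
    congr 1
    simp [mul_nonsing_inv L ((isUnit_iff_isUnit_det L).1 hL)]

end Diagonalization

/-! ### Truncated normal distributions -/

theorem lemma3p4 :
    ∃ C : ℝ → ℝ,
      (∀ α : ℝ, 0 < α → α ≤ 1 → 0 < C α ∧ C α < α / 8) ∧
      (∃ c : ℝ, 0 < c ∧ ∀ α : ℝ, 0 < α → α ≤ 1 → c * α ^ 3 ≤ C α) ∧
      ∀ (α : ℝ), 0 < α → α ≤ 1 →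
      ∀ (d : ℕ) (μ₁ μ₂ : EuclideanSpace ℝ (Fin d)) (Sig₁ Sig₂ : Matrix (Fin d) (Fin d) ℝ)
        (S₁ S₂ : Set (EuclideanSpace ℝ (Fin d))),
        Sig₁.PosDef → Sig₂.PosDef → MeasurableSet S₁ → MeasurableSet S₂ →
        α ≤ (multivariateGaussian μ₁ Sig₁).real S₁ →
        α ≤ (multivariateGaussian μ₂ Sig₂).real S₂ →
        C α * tvDist (multivariateGaussian μ₁ Sig₁) (multivariateGaussian μ₂ Sig₂) ≤
          tvDist (truncatedNormal μ₁ Sig₁ S₁) (truncatedNormal μ₂ Sig₂ S₂) := by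
  have hK := one_le_smallBallConst
  have hC := two_le_tvUpperConst
  have hden : 64 ≤ 32 * smallBallConst ^ 2 * tvUpperConst := by nlinarith
  refine ⟨fun α ↦ α ^ 2 / (32 * smallBallConst ^ 2 * tvUpperConst), ?_, ?_, ?_⟩
  · intro α hα hα1
    refine ⟨by positivity, ?_⟩
    rw [div_lt_iff₀ (by linarith)]
    nlinarith
  · refine ⟨(32 * smallBallConst ^ 2 * tvUpperConst)⁻¹, by positivity, fun α hα hα1 ↦ ?_⟩
    rw [inv_mul_eq_div]
    change _ ≤ α ^ 2 / (32 * smallBallConst ^ 2 * tvUpperConst)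
    gcongr ?_ / _
    exact pow_le_pow_of_le_one hα.le hα1 (by norm_num)
  · intro α hα hα1 d μ₁ μ₂ Sig₁ Sig₂ S₁ S₂ hSig₁ hSig₂ hS₁ hS₂ h₁ h₂
    obtain ⟨e, m, v, hv, hP, hQ⟩ := exists_measurableEquiv_map_pi μ₁ μ₂ hSig₁ hSig₂
    rw [hP, map_measureReal_apply e.measurable hS₁] at h₁
    rw [hQ, map_measureReal_apply e.measurable hS₂] at h₂
    have hmain := mul_tvDist_pi_le_tvDist_cond m hv (e.measurable hS₁) (e.measurable hS₂)
      hα hα1 h₁ (hα.trans_le h₂)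
    have hpos : ∀ {ν : Measure (Fin d → ℝ)} [IsProbabilityMeasure ν]
        {S : Set (EuclideanSpace ℝ (Fin d))}, MeasurableSet S → α ≤ ν.real (e ⁻¹' S) →
        IsProbabilityMeasure (cond (ν.map e) S) := by
      intro ν _ S hS h
      refine cond_isProbabilityMeasure fun h0 ↦ ?_
      rw [Measure.map_apply e.measurable hS] at h0
      rw [measureReal_def, h0, ENNReal.toReal_zero] at h
      linarith
    have := hpos hS₁ h₁
    have := hpos hS₂ h₂
    rw [truncatedNormal, truncatedNormal, hP, hQ]
    calc _ ≤ α ^ 2 / (32 * smallBallConst ^ 2 * tvUpperConst) * _ :=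
          mul_le_mul_of_nonneg_left (tvDist_map_le _ _ e.measurable) (by positivity)
      _ ≤ _ := hmain
      _ ≤ _ := by
          rw [cond_eq_map_cond_map _ e hS₁, cond_eq_map_cond_map _ e hS₂]
          exact tvDist_map_le _ _ e.symm.measurable
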